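/- For $n\in\mathbb N$ and $p\in[0,1]$ let $G_{n,p}$ be the binomial (Erdős–Rényi) random graph on $n$ vertices. For finite graphs $G,J$ let $N(G,J)$ be the number of (not necessarily induced) subgraphs of $G$ isomorphic to $J$, and let $\mathbb E_pX_J=\mathbb E\,N(G_{n,p},J)$. For $q\in[0,1]$, a finite graph $H$ is called $q$-sparse (with respect to $n$) if $\mathbb E_qX_I\ge 1$ for every subgraph $I\subseteq H$. **Theorem.** For every integer $\Delta\ge 1$ there is a real number $L=L(\Delta)>0$ such that the following holds for all $n$, all $q\in(0,1]$ with $p:=Lq\le 1$, and all finite graphs $H$ and $F$. If $H$ is $q$-sparse and $F$ is a tree with maximum degree $\Delta$ and at most $n$ vertices, then $$N(H,F)<\mathbb E_pX_F .$$ -/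

import Mathlib

open scoped unitInterval

/-- `E_p X_J`: the expected number of (unlabelled, not necessarily induced) copies of `J` in the
binomial random graph `G_{n,p}` on the vertex set `Fin n`. The law `G_{n,p}` is
`SimpleGraph.binomialRandom (Fin n) p`, and `G.copyCount J` is the number of subgraphs of `G`
isomorphic to `J`. -/
noncomputable def expectedCopyCount {W : Type*} (n : ℕ) (p : I) (J : SimpleGraph W) : ℝ :=
  ∫ G : SimpleGraph (Fin n), (G.copyCount J : ℝ) ∂(SimpleGraph.binomialRandom (Fin n) p)

/-- `J` is `q`-sparse (with respect to `n`) if `E_q X_S ≥ 1` for every subgraph `S` of `J`. -/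
def IsSparse {V : Type*} (n : ℕ) (q : I) (J : SimpleGraph V) : Prop :=
  ∀ S : J.Subgraph, 1 ≤ expectedCopyCount n q S.coe

/-! Let `d = nq`, let `F` have `e` edges, and count labelled copies. As `K_n` contains
`n(n-1)...(n-e) ≥ exp(-(e+1)) n^(e+1)` of them, it suffices that `H` has at most `28 n (K d)^e`,
with `K` depending only on `Δ`. Copies are sorted by their total degree `k`, the sum of the
`H`-degrees of their vertices.

Rooted count (`card_copies_rooted_le`): for every `t > 0`, at most `t^e exp(Δk/t)` copies of total
degree at most `k` have a given root image. If `d ≥ 1` and `k < 28ed`, taking `t = Δd` and at most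
`n` root images is enough.

Packing (`IsSparse.card_disjoint_copies_le`): `m` disjoint copies of total degree at least `k`, with
all edges meeting them, form a subgraph `J` of `H` with at least `mk/2` edges. Sparsity forbids `J`
from having too few copies in `K_n`, while the interchangeability of the `m` trees saves a factor
`m!`. Hence `m ≤ n d^e exp(O(e max(d,1)) - k/2)`, up to a constant. A maximal disjoint family meets
every copy of total degree `k`, so the rooted count with `t = 8Δ` costs only `exp(k/8)` more, and
the sum over large `k` is geometric. -/

theorem measurableSet_edgeSet_superset {V : Type*} [Finite V] (E : Set (Sym2 V)) :
    MeasurableSet {G : SimpleGraph V | E ⊆ G.edgeSet} := by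
  have hE : MeasurableSet {s : Set (Sym2 V) | E ⊆ s} := (Set.toFinite _).measurableSet
  exact SimpleGraph.measurable_edgeSet hE

open MeasureTheory ProbabilityTheory in
theorem binomialRandom_real_edgeSet_superset {n : ℕ} (p : I) (E : Finset (Sym2 (Fin n)))
    (hE : ∀ e ∈ E, ¬ e.IsDiag) :
    (SimpleGraph.binomialRandom (Fin n) p).real {G | (E : Set (Sym2 (Fin n))) ⊆ G.edgeSet} =
      (p : ℝ) ^ E.card := by
  rw [measureReal_def, SimpleGraph.binomialRandom_eq_map,
    Measure.map_apply SimpleGraph.measurable_fromEdgeSet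
      (measurableSet_edgeSet_superset (E : Set (Sym2 (Fin n)))), setBernoulli_apply']
  have hset : (fun p : Sym2 (Fin n) → Prop ↦ {i | p i}) ⁻¹'
      (SimpleGraph.fromEdgeSet ⁻¹' {G | (E : Set (Sym2 (Fin n))) ⊆ G.edgeSet}) =
      Set.pi (E : Set (Sym2 (Fin n))) (fun _ ↦ {True}) := by
    ext s
    simp only [Set.mem_preimage, Set.mem_ofPred_eq, SimpleGraph.edgeSet_fromEdgeSet, Set.mem_pi,
      Set.mem_singleton_iff, eq_iff_iff, iff_true]
    constructor
    · intro h e he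
      exact (h he).1
    · intro h e he
      exact ⟨h e he, hE e he⟩
  rw [hset, Measure.infinitePi_pi _ (fun _ _ ↦ measurableSet_singleton _)]
  have hone : ∀ e ∈ E, (unitInterval.toNNReal p • Measure.dirac
      (e ∈ (Sym2.diagSetᶜ : Set (Sym2 (Fin n)))) +
      unitInterval.toNNReal (σ p) • Measure.dirac False : Measure Prop) {True} =
      (unitInterval.toNNReal p : ENNReal) := by
    intro e he
    have := hE e he
    simp [this]
  rw [Finset.prod_congr rfl hone]
  simp

/-! ### Labelled and unlabelled copies -/

namespace SimpleGraph

variable {V W : Type*}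

/-- Subgraphs of `G` isomorphic to `J` correspond to copies of `J` in the complete graph all of
whose edges lie in `G`. -/
theorem copyCount_eq_card_filter_top [Fintype V] (G : SimpleGraph V) (J : SimpleGraph W) :
    open Classical in
    G.copyCount J = Finset.card {S : (⊤ : SimpleGraph V).Subgraph |
      Nonempty (J ≃g S.coe) ∧ S.edgeSet ⊆ G.edgeSet} := by
  classical
  rw [copyCount]
  refine Finset.card_bij (fun S _ ↦ ⟨S.verts, S.Adj, fun h ↦ (S.adj_sub h).ne, S.edge_vert, S.symm⟩)
    ?_ ?_ ?_
  · intro S hS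
    simp only [Finset.mem_filter, Finset.mem_univ, true_and] at hS ⊢
    exact ⟨hS, S.edgeSet_subset⟩
  · intro S _ T _ h
    have hv := congrArg Subgraph.verts h
    have ha := congrArg Subgraph.Adj h
    exact Subgraph.ext hv ha
  · intro S hS
    simp only [Finset.mem_filter, Finset.mem_univ, true_and] at hS
    refine ⟨⟨S.verts, S.Adj, fun {a b} h ↦ ?_, S.edge_vert, S.symm⟩, ?_, rfl⟩
    · exact hS.2 (show s(a, b) ∈ S.edgeSet from h)
    · simp only [Finset.mem_filter, Finset.mem_univ, true_and]
      exact hS.1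

theorem Iso.ncard_edgeSet_eq {G : SimpleGraph V} {J : SimpleGraph W} (e : G ≃g J) :
    G.edgeSet.ncard = J.edgeSet.ncard :=
  Nat.card_congr e.mapEdgeSet

theorem Subgraph.ncard_edgeSet_coe {G : SimpleGraph V} (S : G.Subgraph) :
    S.coe.edgeSet.ncard = S.edgeSet.ncard := by
  rw [← Subgraph.image_coe_edgeSet_coe]
  exact (Set.ncard_image_of_injective _ (Sym2.map.injective Subtype.val_injective)).symm

theorem labelledCopyCount_eq_natCard [Fintype V] [Fintype W] (G : SimpleGraph V)
    (J : SimpleGraph W) : G.labelledCopyCount J = Nat.card (Copy J G) := by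
  classical
  rw [labelledCopyCount, Nat.card_eq_fintype_card]

theorem copyCount_eq_natCard [Fintype V] (G : SimpleGraph V) (J : SimpleGraph W) :
    G.copyCount J = Nat.card {S : G.Subgraph // Nonempty (J ≃g S.coe)} := by
  classical
  rw [copyCount, Nat.card_eq_fintype_card, Fintype.card_subtype]

/-- After fixing one isomorphism from `J` onto each copy, every labelled copy is uniquely an
automorphism of `J` followed by one of these isomorphisms. -/
theorem card_aut_mul_copyCount [Fintype V] [Fintype W] (G : SimpleGraph V) (J : SimpleGraph W) :
    Nat.card (J ≃g J) * G.copyCount J = G.labelledCopyCount J := by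
  classical
  rw [labelledCopyCount_eq_natCard, copyCount_eq_natCard, mul_comm, ← Nat.card_prod]
  let e (S : {S : G.Subgraph // Nonempty (J ≃g S.coe)}) : J ≃g S.1.coe := S.2.some
  refine Nat.card_congr (Equiv.ofBijective
    (fun x ↦ x.1.1.coeCopy.comp ((e x.1).toCopy.comp x.2.toCopy)) ⟨?_, ?_⟩)
  · rintro ⟨⟨S, hS⟩, f'⟩ ⟨⟨T, hT⟩, g'⟩ h
    have hsub : ∀ (S : {S : G.Subgraph // Nonempty (J ≃g S.coe)}) (f' : J ≃g J),
        (S.1.coeCopy.comp ((e S).toCopy.comp f'.toCopy)).toSubgraph = S.1 := by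
      intro S f'
      let i : J ≃g S.1.coe := f'.trans (e S)
      change Subgraph.map (S.1.hom.comp i.toCopy.toHom) ⊤ = S.1
      simp [Subgraph.map_comp]
    have hST : S = T := by
      have := congrArg Copy.toSubgraph h
      rwa [hsub, hsub] at this
    subst hST
    congr 1
    ext a
    have ha := DFunLike.congr_fun h a
    have ha' := Subtype.val_injective ha
    exact (e ⟨S, hS⟩).injective ha'
  · intro f
    let S : {S : G.Subgraph // Nonempty (J ≃g S.coe)} := ⟨f.toSubgraph, ⟨f.isoToSubgraph⟩⟩
    refine ⟨⟨S, f.isoToSubgraph.trans (e S).symm⟩, ?_⟩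
    ext a
    change (((e S) ((e S).symm (f.isoToSubgraph a)) : f.toSubgraph.verts) : V) = f a
    rw [RelIso.apply_symm_apply]
    rfl

theorem labelledCopyCount_top [Fintype V] [Fintype W] (J : SimpleGraph W) :
    (⊤ : SimpleGraph V).labelledCopyCount J =
      (Fintype.card V).descFactorial (Fintype.card W) := by
  classical
  rw [labelledCopyCount_eq_natCard, ← Fintype.card_embedding_eq, ← Nat.card_eq_fintype_card]
  exact Nat.card_congr ⟨Copy.toEmbedding,
    fun f ↦ ⟨⟨f, fun h ↦ by simpa using h.ne⟩, f.injective⟩, fun f ↦ rfl, fun f ↦ rfl⟩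

end SimpleGraph

-- Linearity of expectation over the copies of `J` in the complete graph.
open MeasureTheory in
theorem expectedCopyCount_eq {W : Type*} (n : ℕ) (p : I) (J : SimpleGraph W) :
    expectedCopyCount n p J =
      (p : ℝ) ^ J.edgeSet.ncard * (⊤ : SimpleGraph (Fin n)).copyCount J := by
  classical
  obtain ⟨T, hT⟩ : ∃ T : Finset (⊤ : SimpleGraph (Fin n)).Subgraph,
      ∀ S, S ∈ T ↔ Nonempty (J ≃g S.coe) :=
    ⟨(Set.toFinite {S | Nonempty (J ≃g S.coe)}).toFinset, fun S ↦ by simp⟩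
  have hcount : ∀ G : SimpleGraph (Fin n), (G.copyCount J : ℝ) =
      ∑ S ∈ T,
        Set.indicator {G : SimpleGraph (Fin n) | S.edgeSet ⊆ G.edgeSet} (fun _ ↦ (1 : ℝ)) G := by
    intro G
    have : G.copyCount J = (T.filter fun S ↦ S.edgeSet ⊆ G.edgeSet).card := by
      rw [SimpleGraph.copyCount_eq_card_filter_top]
      congr 1
      ext S
      simp only [Finset.mem_filter, Finset.mem_univ, true_and, hT]
    rw [this, Finset.card_filter]
    push_cast
    simp only [Set.indicator_apply, Set.mem_ofPred_eq]
  have hcard : (⊤ : SimpleGraph (Fin n)).copyCount J = T.card := by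
    rw [SimpleGraph.copyCount]
    congr 1
    ext S
    simp only [Finset.mem_filter, Finset.mem_univ, true_and, hT]
  rw [hcard]
  simp_rw [expectedCopyCount, hcount]
  rw [integral_finsetSum _ fun S _ ↦
    (integrable_const (1 : ℝ)).indicator (measurableSet_edgeSet_superset S.edgeSet),
    mul_comm, ← nsmul_eq_mul]
  refine Finset.sum_eq_card_nsmul fun S hS ↦ ?_
  obtain ⟨e⟩ := (hT S).1 hS
  rw [integral_indicator_const _ (measurableSet_edgeSet_superset S.edgeSet), smul_eq_mul, mul_one,
    e.ncard_edgeSet_eq, S.ncard_edgeSet_coe]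
  have := binomialRandom_real_edgeSet_superset p S.edgeSet.toFinset (fun e he ↦ by
    rw [Set.mem_toFinset] at he
    exact (⊤ : SimpleGraph (Fin n)).not_isDiag_of_mem_edgeSet (S.edgeSet_subset he))
  rw [Set.coe_toFinset] at this
  rw [this, Set.ncard_eq_toFinset_card']

/-! ### Copies in the complete graph of a union of disjoint trees with extra edges -/

namespace SimpleGraph

variable {V W U : Type*}

/-- The edges of the images of `F` under a family of maps indexed by `ι`. -/
noncomputable def familyEdges {ι : Type*} [Fintype ι] [Fintype W] (F : SimpleGraph W)
    (f : ι × W → U) : Finset (Sym2 U) := by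
  classical exact (Finset.univ ×ˢ F.edgeFinset).image fun x ↦ x.2.map fun w ↦ f (x.1, w)

theorem image_familyEdges {ι : Type*} [Fintype ι] [Fintype W] [DecidableEq V]
    (F : SimpleGraph W) (f : ι × W → U) (g : U → V) :
    (familyEdges F f).image (Sym2.map g) = familyEdges F (g ∘ f) := by
  classical
  ext x
  simp [familyEdges, Sym2.map_map]

/-- This invariance is the source of the factor `m!`: reordering the trees changes the encoding of a
copy but not its edges. -/
theorem familyEdges_comp_perm {ι : Type*} [Fintype ι] [Fintype W] (F : SimpleGraph W)
    (f : ι × W → U) (s : Equiv.Perm ι) :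
    familyEdges F (fun x ↦ f (s x.1, x.2)) = familyEdges F f := by
  classical
  ext e
  simp only [familyEdges, Finset.mem_image, Finset.mem_product, Finset.mem_univ, true_and,
    Prod.exists]
  constructor
  · rintro ⟨i, e', h, rfl⟩
    exact ⟨s i, e', h, rfl⟩
  · rintro ⟨i, e', h, rfl⟩
    exact ⟨s.symm i, e', h, by simp⟩

theorem card_familyEdges {ι : Type*} [Fintype ι] [Fintype W] (F : SimpleGraph W)
    (f : ι × W → U) (hf : Function.Injective f) :
    (familyEdges F f).card = Fintype.card ι * F.edgeSet.ncard := by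
  classical
  rw [familyEdges, Finset.card_image_of_injective, Finset.card_product, Finset.card_univ,
    Set.ncard_eq_toFinset_card']
  · rfl
  · rintro ⟨i, e⟩ ⟨j, e'⟩ h
    have hij : i = j := by
      induction e with | _ a b =>
      induction e' with | _ a' b' =>
      simp only [Sym2.map_mk, Sym2.eq_iff] at h
      rcases h with h | h
      · exact congrArg Prod.fst (hf h.1)
      · exact congrArg Prod.fst (hf h.1)
    subst hij
    congr 1
    refine Sym2.map.injective (f := fun w ↦ f (i, w)) (fun a b hab ↦ ?_) h
    exact congrArg Prod.snd (hf hab)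

theorem Subgraph.eq_of_edgeSet_eq {G : SimpleGraph V} {S T : G.Subgraph}
    (hS : ∀ v ∈ S.verts, ∃ w, S.Adj v w) (hT : ∀ v ∈ T.verts, ∃ w, T.Adj v w)
    (h : S.edgeSet = T.edgeSet) : S = T := by
  have hadj : ∀ a b, S.Adj a b ↔ T.Adj a b := by
    intro a b
    rw [← Subgraph.mem_edgeSet, h, Subgraph.mem_edgeSet]
  refine Subgraph.ext (Set.ext fun a ↦ ⟨fun ha ↦ ?_, fun ha ↦ ?_⟩) (by ext a b; exact hadj a b)
  · obtain ⟨b, hb⟩ := hS a ha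
    exact T.edge_vert ((hadj a b).1 hb)
  · obtain ⟨b, hb⟩ := hT a ha
    exact S.edge_vert ((hadj a b).2 hb)

theorem familyEdges_subset [Fintype U] [Fintype W] {ι : Type*} [Fintype ι]
    (J : SimpleGraph U) (F : SimpleGraph W) (φ : ι → Copy F J) [DecidableRel J.Adj] :
    familyEdges F (fun x : ι × W ↦ φ x.1 x.2) ⊆ J.edgeFinset := by
  classical
  intro e he
  simp only [familyEdges, Finset.mem_image, Finset.mem_product, Finset.mem_univ, true_and,
    Prod.exists] at he
  obtain ⟨i, e', h, rfl⟩ := he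
  rw [mem_edgeFinset] at h ⊢
  exact (φ i).toHom.map_mem_edgeSet h

theorem mul_ncard_edgeSet_le [Fintype U] [Fintype W] {m : ℕ} (J : SimpleGraph U)
    (F : SimpleGraph W) (φ : Fin m → Copy F J)
    (hφ : Function.Injective fun x : Fin m × W ↦ φ x.1 x.2) :
    m * F.edgeSet.ncard ≤ J.edgeSet.ncard := by
  classical
  have := Finset.card_le_card (familyEdges_subset J F φ)
  rwa [card_familyEdges _ _ hφ, Fintype.card_fin, ← Set.ncard_coe_finset, coe_edgeFinset] at this

/-- A graph `J` without isolated vertices all of whose edges meet the union of `m` disjoint copies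
of `F` has few copies in the complete graph: a copy is determined by the position of the copies of
`F` together with the remaining edges, and `m!` orderings of the former describe the same copy. -/
theorem copyCount_top_mul_factorial_le [Fintype U] [Fintype W] [Nonempty W] (n m : ℕ)
    (J : SimpleGraph U) (F : SimpleGraph W) (hJ : ∀ a, ∃ b, J.Adj a b) (φ : Fin m → Copy F J)
    (hφ : Function.Injective fun x : Fin m × W ↦ φ x.1 x.2)
    (htouch : ∀ a b, J.Adj a b → a ∈ Set.range (fun x : Fin m × W ↦ φ x.1 x.2) ∨
      b ∈ Set.range fun x : Fin m × W ↦ φ x.1 x.2) :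
    (⊤ : SimpleGraph (Fin n)).copyCount J * m.factorial ≤
      n ^ (m * Fintype.card W) *
        (m * Fintype.card W * n).choose (J.edgeSet.ncard - m * F.edgeSet.ncard) := by
  classical
  set ψ : Fin m × W → U := fun x ↦ φ x.1 x.2 with hψ
  set T := familyEdges F ψ with hT
  have hTJ : T ⊆ J.edgeFinset := familyEdges_subset J F φ
  let e (S : {S : (⊤ : SimpleGraph (Fin n)).Subgraph // Nonempty (J ≃g S.coe)}) : J ≃g S.1.coe :=
    S.2.some
  let g (S : {S : (⊤ : SimpleGraph (Fin n)).Subgraph // Nonempty (J ≃g S.coe)}) : U → Fin n :=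
    fun a ↦ e S a
  have hg : ∀ S, Function.Injective (g S) := fun S ↦
    Subtype.val_injective.comp (e S).injective
  have hgedge : ∀ S, S.1.edgeSet = Sym2.map (g S) '' J.edgeSet := by
    intro S
    ext x
    induction x with | _ a b =>
    rw [Subgraph.mem_edgeSet]
    constructor
    · intro h
      refine ⟨s((e S).symm ⟨a, S.1.edge_vert h⟩, (e S).symm ⟨b, S.1.edge_vert h.symm⟩), ?_, ?_⟩
      · rw [mem_edgeSet, (e S).symm.map_adj_iff]
        exact h
      · simp [g]
    · rintro ⟨x, hx, hxab⟩
      induction x with | _ c d =>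
      rw [mem_edgeSet, ← (e S).map_adj_iff] at hx
      have h' : S.1.Adj (g S c) (g S d) := hx
      rw [Sym2.map_mk, Sym2.eq_iff] at hxab
      rcases hxab with ⟨rfl, rfl⟩ | ⟨rfl, rfl⟩
      · exact h'
      · exact h'.symm
  have hnoiso : ∀ S : {S : (⊤ : SimpleGraph (Fin n)).Subgraph // Nonempty (J ≃g S.coe)},
      ∀ v ∈ S.1.verts, ∃ w, S.1.Adj v w := by
    intro S v hv
    obtain ⟨b, hb⟩ := hJ ((e S).symm ⟨v, hv⟩)
    rw [← (e S).map_adj_iff, RelIso.apply_symm_apply] at hb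
    exact ⟨_, hb⟩
  -- The pairs with an end among the placed tree vertices; all remaining edges of the copy lie here.
  let P (f : Fin m × W → Fin n) : Finset (Sym2 (Fin n)) :=
    Finset.univ.image fun x : (Fin m × W) × Fin n ↦ s(f x.1, x.2)
  set r := J.edgeSet.ncard - m * F.edgeSet.ncard with hr
  have hrcard : (J.edgeFinset \ T).card = r := by
    rw [Finset.card_sdiff_of_subset hTJ, hT, card_familyEdges F ψ hφ, Fintype.card_fin, hr,
      ← Set.ncard_coe_finset, coe_edgeFinset]
  -- A copy together with an ordering of its trees is encoded by the tree positions in that order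
  -- and the set of edges outside the trees.
  let data (x : {S : (⊤ : SimpleGraph (Fin n)).Subgraph // Nonempty (J ≃g S.coe)} ×
      Equiv.Perm (Fin m)) : (_ : Fin m × W → Fin n) × Finset (Sym2 (Fin n)) :=
    ⟨fun y ↦ g x.1 (ψ (x.2 y.1, y.2)), (J.edgeFinset \ T).image (Sym2.map (g x.1))⟩
  have hmaps : ∀ x ∈ (Finset.univ : Finset ({S : (⊤ : SimpleGraph (Fin n)).Subgraph //
      Nonempty (J ≃g S.coe)} × Equiv.Perm (Fin m))),
      data x ∈ Finset.univ.sigma fun f ↦ (P f).powersetCard r := by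
    rintro ⟨S, s⟩ -
    simp only [Finset.mem_sigma, Finset.mem_univ, true_and, Finset.mem_powersetCard, data]
    constructor
    · intro x hx
      obtain ⟨y, hy, rfl⟩ := Finset.mem_image.1 hx
      rw [Finset.mem_sdiff, mem_edgeFinset] at hy
      replace hy := hy.1
      induction y with | _ a b =>
      simp only [P, Finset.mem_image, Finset.mem_univ, true_and, Prod.exists, Sym2.map_mk]
      rcases htouch a b hy with ⟨⟨i, w⟩, rfl⟩ | ⟨⟨i, w⟩, rfl⟩
      · exact ⟨s.symm i, w, g S b, by simp⟩
      · exact ⟨s.symm i, w, g S a, by simp [Sym2.eq_swap]⟩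
    · rw [Finset.card_image_of_injective _ (Sym2.map.injective (hg S)), hrcard]
  have hinj : Function.Injective data := by
    rintro ⟨S, s⟩ ⟨S', s'⟩ h
    have h1 : (fun y : Fin m × W ↦ g S (ψ (s y.1, y.2))) =
        fun y ↦ g S' (ψ (s' y.1, y.2)) := congrArg Sigma.fst h
    have h2 : (J.edgeFinset \ T).image (Sym2.map (g S)) =
        (J.edgeFinset \ T).image (Sym2.map (g S')) := by
      have := (Sigma.mk.inj_iff.1 h).2
      exact eq_of_heq this
    have h3 : T.image (Sym2.map (g S)) = T.image (Sym2.map (g S')) := by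
      rw [hT, image_familyEdges, image_familyEdges, ← familyEdges_comp_perm F (g S ∘ ψ) s,
        ← familyEdges_comp_perm F (g S' ∘ ψ) s']
      exact congrArg _ h1
    have h4 : J.edgeFinset.image (Sym2.map (g S)) = J.edgeFinset.image (Sym2.map (g S')) := by
      rw [← Finset.sdiff_union_of_subset hTJ, Finset.image_union, Finset.image_union, h2, h3]
    -- The code gives all edges, and without isolated vertices these determine the copy.
    have hS : S = S' := by
      refine Subtype.ext (Subgraph.eq_of_edgeSet_eq (hnoiso S) (hnoiso S') ?_)
      rw [hgedge, hgedge, ← coe_edgeFinset, ← Finset.coe_image, ← Finset.coe_image, h4]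
    subst hS
    congr 1
    ext1 i
    obtain ⟨w⟩ := ‹Nonempty W›
    have := hφ (hg S (congrFun h1 (i, w)))
    exact congrArg Prod.fst this
  have hcard := Finset.card_le_card_of_injOn data hmaps hinj.injOn
  rw [Finset.card_univ, Fintype.card_prod, Fintype.card_perm, Fintype.card_fin,
    ← Nat.card_eq_fintype_card, ← copyCount_eq_natCard, Finset.card_sigma] at hcard
  refine hcard.trans ?_
  refine (Finset.sum_le_card_nsmul _ _ ((m * Fintype.card W * n).choose r) fun f _ ↦ ?_).trans ?_
  · rw [Finset.card_powersetCard]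
    refine Nat.choose_le_choose _ (Finset.card_image_le.trans ?_)
    simp
  · simp

end SimpleGraph

/-! ### First moment bound for disjoint copies -/

/-- Replace `m!` by `(m / exp 1)^m` and take `m`-th roots. The decay `exp(-k/2)` comes from `r ≥
mk/2 - me`. -/
theorem le_of_factorial_le_of_choose {m e v k r : ℕ} {n q D : ℝ} (hn : 0 ≤ n)
    (hq : 0 ≤ q) (hD : n * q ≤ D) (N : ℕ) (hN : (N : ℝ) = m * v * n) (hv : v = e + 1)
    (hk : m * k ≤ 2 * (r + m * e))
    (h : (m.factorial : ℝ) ≤ q ^ (r + m * e) * (n ^ (m * v) * N.choose r)) :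
    (m : ℝ) ≤ Real.exp 1 * n * (n * q) ^ e * Real.exp (Real.exp 1 * v * D + e - k / 2) := by
  have hd : 0 ≤ n * q := by positivity
  have hD0 : 0 ≤ D := hd.trans hD
  rcases Nat.eq_zero_or_pos m with rfl | hm
  · simp only [Nat.cast_zero]
    positivity
  have hfac : (m : ℝ) ^ m ≤ Real.exp 1 ^ m * m.factorial := by
    have := Real.pow_div_factorial_le_exp (m : ℝ) (by positivity) m
    rw [div_le_iff₀ (by positivity)] at this
    simpa [← Real.exp_nat_mul] using this
  have hchoose : q ^ r * (N.choose r : ℝ) ≤ Real.exp (Real.exp 1 * (m * v * D)) * Real.exp (-r) := by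
    calc q ^ r * (N.choose r : ℝ) ≤ q ^ r * ((N : ℝ) ^ r / r.factorial) := by
          gcongr
          exact Nat.choose_le_pow_div r N
      _ = (m * v * (n * q)) ^ r / r.factorial := by rw [hN, mul_div_assoc', ← mul_pow]; ring
      _ ≤ (m * v * D) ^ r / r.factorial := by gcongr
      -- Enlarging the base by `exp 1` is what produces the gain `exp(-r)`; the rest is one term of
      -- an exponential series.
      _ = (Real.exp 1 * (m * v * D)) ^ r / r.factorial * Real.exp (-r) := by
          have : Real.exp (r : ℝ) = Real.exp 1 ^ r := by rw [← Real.exp_nat_mul, mul_one]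
          rw [mul_pow (Real.exp 1), Real.exp_neg, this]
          field_simp
      _ ≤ _ := by
          gcongr
          exact Real.pow_div_factorial_le_exp _ (by positivity) r
  have hk' : (m : ℝ) * k ≤ 2 * (r + m * e) := by exact_mod_cast hk
  have hpow : (m : ℝ) ^ m ≤
      (Real.exp 1 * n * (n * q) ^ e * Real.exp (Real.exp 1 * v * D + e - k / 2)) ^ m := by
    calc (m : ℝ) ^ m ≤ Real.exp 1 ^ m * (q ^ (r + m * e) * (n ^ (m * v) * N.choose r)) :=
          hfac.trans (by gcongr)
      _ = Real.exp 1 ^ m * (n ^ m * (n * q) ^ (m * e)) * (q ^ r * N.choose r) := by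
          rw [hv]; ring
      _ ≤ Real.exp 1 ^ m * (n ^ m * (n * q) ^ (m * e)) *
          (Real.exp (Real.exp 1 * (m * v * D)) * Real.exp (-r)) := by gcongr
      _ ≤ Real.exp 1 ^ m * (n ^ m * (n * q) ^ (m * e)) *
          Real.exp (m * (Real.exp 1 * v * D + e - k / 2)) := by
          rw [← Real.exp_add]
          gcongr
          linarith
      _ = _ := by
          rw [Real.exp_nat_mul]
          ring
  exact (pow_le_pow_iff_left₀ (by positivity) (by positivity) hm.ne').1 hpow

namespace SimpleGraph

variable {V W : Type*}

/-- The subgraph formed by all edges that meet a given set of vertices. -/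
def edgesMeeting (H : SimpleGraph V) (S : Set V) : H.Subgraph where
  verts := {a | ∃ b, H.Adj a b ∧ (a ∈ S ∨ b ∈ S)}
  Adj a b := H.Adj a b ∧ (a ∈ S ∨ b ∈ S)
  adj_sub h := h.1
  edge_vert h := ⟨_, h⟩
  symm := ⟨fun _ _ h ↦ ⟨h.1.symm, h.2.symm⟩⟩

theorem sum_le_twice_ncard_edgeSet {X U : Type*} [Fintype X] [Finite U] (J : SimpleGraph U)
    (f : X → U) (hf : Function.Injective f) {d : X → ℕ}
    (hd : ∀ x, d x ≤ Nat.card (J.neighborSet (f x))) :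
    ∑ x, d x ≤ 2 * J.edgeSet.ncard := by
  classical
  cases nonempty_fintype U
  simp only [Nat.card_eq_fintype_card, card_neighborSet_eq_degree] at hd
  calc ∑ x, d x ≤ ∑ x, J.degree (f x) := Finset.sum_le_sum fun x _ ↦ hd x
    _ = ∑ a ∈ Finset.univ.image f, J.degree a := by rw [Finset.sum_image hf.injOn]
    _ ≤ ∑ a, J.degree a := Finset.sum_le_sum_of_subset (Finset.subset_univ _)
    _ = 2 * J.edgeSet.ncard := by
        rw [sum_degrees_eq_twice_card_edges, ← Set.ncard_coe_finset, coe_edgeFinset]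

/-- Disjoint copies of `F` in a sparse graph `H`, each of total degree at least `k`, obey the first
moment bound applied to the subgraph of all edges that meet them. -/
theorem _root_.IsSparse.exists_factorial_le [Fintype V] [Fintype W] [Nonempty W] {n m k : ℕ} {q : I}
    {H : SimpleGraph V} [DecidableRel H.Adj] (hH : IsSparse n q H) {F : SimpleGraph W}
    (hF : ∀ w, ∃ w', F.Adj w w') (φ : Fin m → Copy F H)
    (hφ : Function.Injective fun x : Fin m × W ↦ φ x.1 x.2)
    (hk : ∀ i, k ≤ ∑ w, H.degree (φ i w)) :
    ∃ r : ℕ, m * k ≤ 2 * (r + m * F.edgeSet.ncard) ∧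
      (m.factorial : ℝ) ≤ (q : ℝ) ^ (r + m * F.edgeSet.ncard) *
        ((n : ℝ) ^ (m * Fintype.card W) * (m * Fintype.card W * n).choose r) := by
  classical
  set ψ : Fin m × W → V := fun x ↦ φ x.1 x.2 with hψ
  set J := H.edgesMeeting (Set.range ψ) with hJ
  have hmem : ∀ x, ψ x ∈ J.verts := by
    rintro ⟨i, w⟩
    obtain ⟨w', h⟩ := hF w
    exact ⟨φ i w', (φ i).toHom.map_adj h, Or.inl ⟨(i, w), rfl⟩⟩
  let φ' (i : Fin m) : Copy F J.coe :=
    ⟨⟨fun w ↦ ⟨φ i w, hmem (i, w)⟩, fun {a b} h ↦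
      ⟨(φ i).toHom.map_adj h, Or.inl ⟨(i, a), rfl⟩⟩⟩,
      fun a b h ↦ (φ i).injective (congrArg Subtype.val h)⟩
  have hφ' : Function.Injective fun x : Fin m × W ↦ φ' x.1 x.2 := fun x y h ↦
    hφ (congrArg Subtype.val h)
  have hle := mul_ncard_edgeSet_le J.coe F φ' hφ'
  have hcount := copyCount_top_mul_factorial_le n m J.coe F
    (fun ⟨a, b, h⟩ ↦ ⟨⟨b, J.edge_vert (J.adj_symm h)⟩, h⟩) φ' hφ' (by
      rintro ⟨a, ha⟩ ⟨b, hb⟩ ⟨-, h | h⟩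
      · obtain ⟨x, rfl⟩ := h
        exact Or.inl ⟨x, rfl⟩
      · obtain ⟨x, rfl⟩ := h
        exact Or.inr ⟨x, rfl⟩)
  have hsparse := hH J
  rw [expectedCopyCount_eq] at hsparse
  refine ⟨J.coe.edgeSet.ncard - m * F.edgeSet.ncard, ?_, ?_⟩
  · rw [Nat.sub_add_cancel hle]
    -- Tree vertices keep their full `H`-degree in `J`, since `J` contains every edge meeting them.
    have hsum := sum_le_twice_ncard_edgeSet J.coe _ hφ' (d := fun x ↦ H.degree (ψ x)) (by
      rintro ⟨i, w⟩
      rw [← card_neighborSet_eq_degree, ← Nat.card_eq_fintype_card]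
      refine Nat.card_le_card_of_injective
        (fun b ↦ ⟨⟨b.1, ψ (i, w), b.2.symm, Or.inr ⟨(i, w), rfl⟩⟩, b.2, Or.inl ⟨(i, w), rfl⟩⟩) ?_
      intro b c h
      exact Subtype.ext (congrArg (fun z ↦ z.1.1) h))
    rw [Fintype.sum_prod_type] at hsum
    calc m * k = ∑ _i : Fin m, k := by simp
      _ ≤ ∑ i, ∑ w, H.degree (φ i w) := Finset.sum_le_sum fun i _ ↦ hk i
      _ ≤ 2 * J.coe.edgeSet.ncard := hsum
  · rw [Nat.sub_add_cancel hle]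
    have hcount' : ((⊤ : SimpleGraph (Fin n)).copyCount J.coe : ℝ) * m.factorial ≤
        (n : ℝ) ^ (m * Fintype.card W) * (m * Fintype.card W * n).choose
          (J.coe.edgeSet.ncard - m * F.edgeSet.ncard) := by exact_mod_cast hcount
    have hq : (0 : ℝ) ≤ q := q.2.1
    calc (m.factorial : ℝ) ≤ ((q : ℝ) ^ J.coe.edgeSet.ncard *
          (⊤ : SimpleGraph (Fin n)).copyCount J.coe) * m.factorial :=
          le_mul_of_one_le_left (by positivity) hsparse
      _ = (q : ℝ) ^ J.coe.edgeSet.ncard *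
          ((⊤ : SimpleGraph (Fin n)).copyCount J.coe * m.factorial) := by ring
      _ ≤ _ := by gcongr

/-- A sparse graph has few disjoint copies of `F` of large total degree. -/
theorem _root_.IsSparse.card_disjoint_copies_le [Fintype V] [Fintype W] [Nonempty W] {n m k : ℕ}
    {q : I} {H : SimpleGraph V} [DecidableRel H.Adj] (hH : IsSparse n q H) {F : SimpleGraph W}
    (hF : ∀ w, ∃ w', F.Adj w w') {e : ℕ} (he : F.edgeSet.ncard = e)
    (hv : Fintype.card W = e + 1) {D : ℝ} (hD : n * (q : ℝ) ≤ D) (φ : Fin m → Copy F H)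
    (hφ : Function.Injective fun x : Fin m × W ↦ φ x.1 x.2)
    (hk : ∀ i, k ≤ ∑ w, H.degree (φ i w)) :
    (m : ℝ) ≤ Real.exp 1 * n * (n * (q : ℝ)) ^ e *
      Real.exp (Real.exp 1 * (e + 1 : ℕ) * D + e - k / 2) := by
  obtain ⟨r, hr, hfac⟩ := hH.exists_factorial_le hF φ hφ hk
  rw [he, hv] at *
  exact le_of_factorial_le_of_choose (Nat.cast_nonneg n) q.2.1 hD _ (by push_cast; ring) rfl hr hfac

/-- Sparsity of `H` itself forces a copy of `H` in `K_n`. -/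
theorem _root_.IsSparse.card_le [Fintype V] {n : ℕ} {q : I} {H : SimpleGraph V}
    (hH : IsSparse n q H) : Fintype.card V ≤ n := by
  classical
  have h := hH ⊤
  rw [expectedCopyCount_eq] at h
  have hpos : 0 < (⊤ : SimpleGraph (Fin n)).copyCount (⊤ : H.Subgraph).coe := by
    rw [Nat.pos_iff_ne_zero]
    intro h0
    rw [h0] at h
    norm_num at h
  obtain ⟨f⟩ := copyCount_pos.1 hpos
  have := Fintype.card_le_of_injective (fun a : V ↦ f ⟨a, trivial⟩) fun a b hab ↦
    congrArg Subtype.val (f.injective hab)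
  simpa using this

end SimpleGraph

/-! ### Weighted count of rooted tree maps -/

namespace SimpleGraph

variable {V W : Type*}

/-- A weighted count of the maps of a rooted tree, given by its parent function `π`, into a graph:
if `g` is at most the inverse of the degree, then the maps with a given image of the root have total
weight at most one. -/
theorem sum_prod_parent_le_one [Fintype V] [Fintype W] [DecidableEq W] [DecidableEq V]
    (H : SimpleGraph V)
    [DecidableRel H.Adj] (g : V → ℝ) (hg : ∀ a, 0 ≤ g a) (hdeg : ∀ a, H.degree a * g a ≤ 1)
    (x₀ : W) (π : W → W) (h : W → ℕ) (hπ : ∀ y, y ≠ x₀ → h (π y) < h y) (u : V)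
    (s : Finset W) (hs : x₀ ∉ s) (hclosed : ∀ y ∈ s, π y ∈ s ∨ π y = x₀) :
    ∑ φ : W → V with (∀ y ∉ s, φ y = u) ∧ ∀ y ∈ s, H.Adj (φ (π y)) (φ y),
      ∏ y ∈ s, g (φ (π y)) ≤ 1 := by
  induction s using Finset.induction_on_max_value h with
  | empty =>
    simp only [Finset.prod_empty, Finset.sum_const, nsmul_eq_mul, mul_one]
    norm_cast
    rw [Finset.card_le_one]
    intro a ha b hb
    simp only [Finset.mem_filter, Finset.mem_univ, true_and, Finset.notMem_empty,
      not_false_eq_true, forall_true_left] at ha hb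
    ext1 y
    rw [ha.1 y, hb.1 y]
  -- As `a` has maximal height, it is nobody's parent in the set: its image has at most `H.degree (φ
  -- (π a))` choices, each of weight `g (φ (π a))`. Resetting it to `u` groups maps by their
  -- restriction to `s`.
  | insert a s has hmax ih =>
    have hax : a ≠ x₀ := fun h' ↦ hs (h' ▸ Finset.mem_insert_self _ _)
    have hx₀s : x₀ ∉ s := fun h' ↦ hs (Finset.mem_insert_of_mem h')
    have hne : ∀ y ∈ insert a s, π y ≠ a := by
      intro y hy hya
      have h1 := hπ y (fun h' ↦ hs (h' ▸ hy))
      rw [hya] at h1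
      rcases Finset.mem_insert.1 hy with rfl | hy
      · exact lt_irrefl _ h1
      · exact absurd (hmax y hy) (not_le.2 h1)
    have hcs : ∀ y ∈ s, π y ∈ s ∨ π y = x₀ := by
      intro y hy
      rcases hclosed y (Finset.mem_insert_of_mem hy) with h' | h'
      · exact Or.inl ((Finset.mem_insert.1 h').resolve_left (hne y (Finset.mem_insert_of_mem hy)))
      · exact Or.inr h'
    refine le_trans ?_ (ih hx₀s hcs)
    rw [← Finset.sum_fiberwise_of_maps_to (g := fun φ : W → V ↦ Function.update φ a u)
      (t := {φ : W → V | (∀ y ∉ s, φ y = u) ∧ ∀ y ∈ s, H.Adj (φ (π y)) (φ y)})]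
    · refine Finset.sum_le_sum fun φ' _ ↦ ?_
      set T := {φ ∈ ({φ : W → V | (∀ y ∉ insert a s, φ y = u) ∧
        ∀ y ∈ insert a s, H.Adj (φ (π y)) (φ y)} : Finset (W → V)) | Function.update φ a u = φ'}
        with hT
      have hTφ : ∀ φ ∈ T, ∀ y ≠ a, φ y = φ' y := by
        intro φ hφ y hy
        rw [← (Finset.mem_filter.1 hφ).2, Function.update_of_ne hy]
      have hval : ∀ φ ∈ T, ∏ y ∈ insert a s, g (φ (π y)) =
          g (φ' (π a)) * ∏ y ∈ s, g (φ' (π y)) := by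
        intro φ hφ
        rw [Finset.prod_insert has, hTφ φ hφ _ (hne a (Finset.mem_insert_self _ _))]
        congr 1
        exact Finset.prod_congr rfl fun y hy ↦ by
          rw [hTφ φ hφ _ (hne y (Finset.mem_insert_of_mem hy))]
      have hcard : T.card ≤ H.degree (φ' (π a)) := by
        rw [← card_neighborFinset_eq_degree]
        refine Finset.card_le_card_of_injOn (fun φ ↦ φ a) (fun φ hφ ↦ ?_) ?_
        · have h1 := (Finset.mem_filter.1 (Finset.mem_filter.1 hφ).1).2.2 a
            (Finset.mem_insert_self _ _)
          rw [hTφ φ hφ _ (hne a (Finset.mem_insert_self _ _))] at h1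
          simpa using h1
        · intro φ hφ φ₂ hφ₂ hab
          ext1 y
          by_cases hy : y = a
          · rw [hy]; exact hab
          · rw [hTφ φ hφ y hy, hTφ φ₂ hφ₂ y hy]
      rw [Finset.sum_congr rfl hval, Finset.sum_const, nsmul_eq_mul, ← mul_assoc]
      refine mul_le_of_le_one_left (Finset.prod_nonneg fun y _ ↦ hg _) (le_trans ?_ (hdeg (φ' (π a))))
      gcongr
      exact hg _
    · intro φ hφ
      simp only [Finset.mem_filter, Finset.mem_univ, true_and] at hφ ⊢
      constructor
      · intro y hy
        by_cases hya : y = a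
        · rw [hya, Function.update_self]
        · rw [Function.update_of_ne hya]
          exact hφ.1 y (by simp [hya, hy])
      · intro y hy
        have hya : y ≠ a := fun h' ↦ has (h' ▸ hy)
        rw [Function.update_of_ne hya, Function.update_of_ne (hne y (Finset.mem_insert_of_mem hy))]
        exact hφ.2 y (Finset.mem_insert_of_mem hy)

theorem Connected.exists_parent {F : SimpleGraph W} (hF : F.Connected) (x₀ : W) :
    ∃ π : W → W, ∀ y, y ≠ x₀ → F.Adj (π y) y ∧ F.dist x₀ (π y) < F.dist x₀ y := by
  have : ∀ y, ∃ z, y ≠ x₀ → F.Adj z y ∧ F.dist x₀ z < F.dist x₀ y := by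
    intro y
    by_cases hy : y = x₀
    · exact ⟨y, fun h ↦ absurd hy h⟩
    obtain ⟨p, hp⟩ := (hF y x₀).exists_walk_length_eq_dist
    cases p with
    | nil => exact absurd rfl hy
    | @cons _ z _ hadj p =>
      refine ⟨z, fun _ ↦ ⟨hadj.symm, ?_⟩⟩
      rw [dist_comm, F.dist_comm (u := x₀), ← hp, Walk.length_cons]
      exact Nat.lt_succ_of_le (dist_le p)
  choose π hπ using this
  exact ⟨π, hπ⟩

/-- The number of copies of a bounded degree connected graph that send a given vertex to a given
vertex and have total degree at most `k`. -/
theorem card_copies_rooted_le [Fintype V] [Fintype W] {H : SimpleGraph V} [DecidableRel H.Adj]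
    {F : SimpleGraph W} [DecidableRel F.Adj] (hF : F.Connected) {Δ e : ℕ}
    (hΔ : ∀ w, F.degree w ≤ Δ) (hv : Fintype.card W = e + 1) {t : ℝ} (ht : 0 < t) (κ : ℝ)
    (x₀ : W) (u : V) (A : Finset (Copy F H)) (hAu : ∀ φ ∈ A, φ x₀ = u)
    (hAk : ∀ φ ∈ A, (∑ w, H.degree (φ w) : ℝ) ≤ κ) :
    (A.card : ℝ) ≤ t ^ e * Real.exp (Δ * κ / t) := by
  classical
  obtain ⟨π, hπ⟩ := hF.exists_parent x₀
  -- From `x ≤ exp x` at `x = deg / t`; unlike `1 / deg`, this weight has a product controlled by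
  -- the degree sum alone.
  set g : V → ℝ := fun a ↦ Real.exp (-(H.degree a / t)) / t with hg
  have hg0 : ∀ a, 0 ≤ g a := fun a ↦ by positivity
  have hdeg : ∀ a, H.degree a * g a ≤ 1 := by
    intro a
    have h1 := Real.add_one_le_exp ((H.degree a : ℝ) / t)
    calc H.degree a * g a = H.degree a / t / Real.exp (H.degree a / t) := by
          simp only [hg, Real.exp_neg]
          ring
      _ ≤ 1 := (div_le_one (Real.exp_pos _)).2 (by linarith)
  have hsum := sum_prod_parent_le_one H g hg0 hdeg x₀ π (F.dist x₀) (fun y hy ↦ (hπ y hy).2) u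
    (Finset.univ.erase x₀) (by simp) (fun y _ ↦ by
      by_cases h : π y = x₀
      · exact Or.inr h
      · exact Or.inl (by simp [h]))
  have hcard : (Finset.univ.erase x₀).card = e := by
    rw [Finset.card_erase_of_mem (Finset.mem_univ _), Finset.card_univ, hv, Nat.add_sub_cancel]
  -- A vertex is the parent of at most `Δ` others, being adjacent to them.
  have hfiber : ∀ f : W → ℝ, (∀ w, 0 ≤ f w) →
      ∑ y ∈ Finset.univ.erase x₀, f (π y) ≤ Δ * ∑ w, f w := by
    intro f hf
    rw [← Finset.sum_fiberwise_of_maps_to (g := π) (t := Finset.univ) (by simp), Finset.mul_sum]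
    refine Finset.sum_le_sum fun w _ ↦ ?_
    rw [Finset.sum_congr rfl (g := fun _ ↦ f w) fun y hy ↦ by rw [(Finset.mem_filter.1 hy).2],
      Finset.sum_const, nsmul_eq_mul]
    refine mul_le_mul_of_nonneg_right ?_ (hf w)
    norm_cast
    refine (Finset.card_le_card ?_).trans ((card_neighborFinset_eq_degree F w).trans_le (hΔ w))
    intro y hy
    rw [Finset.mem_filter, Finset.mem_erase] at hy
    rw [mem_neighborFinset, ← hy.2]
    exact (hπ y hy.1.1).1
  have hlow : ∀ φ ∈ A, (t ^ e * Real.exp (Δ * κ / t))⁻¹ ≤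
      ∏ y ∈ Finset.univ.erase x₀, g (φ (π y)) := by
    intro φ hφ
    simp only [hg]
    rw [Finset.prod_div_distrib, Finset.prod_const, hcard, ← Real.exp_sum, mul_inv, mul_comm,
      ← Real.exp_neg, ← div_eq_mul_inv, Finset.sum_neg_distrib]
    gcongr
    have h1 := hfiber (fun w ↦ H.degree (φ w) / t) (fun w ↦ by positivity)
    refine h1.trans ?_
    rw [← Finset.sum_div, mul_div_assoc]
    gcongr
    exact hAk φ hφ
  have hA : ∑ φ ∈ A, ∏ y ∈ Finset.univ.erase x₀, g (φ (π y)) ≤ 1 := by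
    refine le_trans ?_ hsum
    rw [← Finset.sum_image (s := A) (g := fun φ : Copy F H ↦ (φ : W → V))
      (f := fun φ ↦ ∏ y ∈ Finset.univ.erase x₀, g (φ (π y))) DFunLike.coe_injective.injOn]
    refine Finset.sum_le_sum_of_subset_of_nonneg ?_ fun φ _ _ ↦ Finset.prod_nonneg fun _ _ ↦ hg0 _
    intro φ hφ
    obtain ⟨φ, hφA, rfl⟩ := Finset.mem_image.1 hφ
    simp only [Finset.mem_filter, Finset.mem_univ, true_and, Finset.mem_erase, and_true,
      not_not, ne_eq]
    exact ⟨fun y hy ↦ hy ▸ hAu φ hφA, fun y hy ↦ φ.toHom.map_adj (hπ y hy).1⟩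
  have := (Finset.card_nsmul_le_sum A _ _ hlow).trans hA
  rw [nsmul_eq_mul, ← div_eq_mul_inv, div_le_one (by positivity)] at this
  exact this

end SimpleGraph

/-! ### Elementary estimates -/

theorem card_le_of_fiber_le_geometric {α : Type*} (A : Finset α) (M : α → ℕ) {C x : ℝ}
    (hC : 0 ≤ C) (hx : 0 ≤ x) (hx1 : x < 1)
    (h : ∀ k, (({a ∈ A | M a = k} : Finset α).card : ℝ) ≤ C * x ^ k) :
    (A.card : ℝ) ≤ C * (1 - x)⁻¹ := by
  classical
  rw [Finset.card_eq_sum_card_image M A]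
  push_cast
  calc ∑ k ∈ A.image M, (({a ∈ A | M a = k} : Finset α).card : ℝ)
      ≤ ∑ k ∈ A.image M, C * x ^ k := Finset.sum_le_sum fun k _ ↦ h k
    _ = C * ∑ k ∈ A.image M, x ^ k := by rw [Finset.mul_sum]
    _ ≤ C * ∑' k, x ^ k := by
        gcongr
        exact (summable_geometric_of_lt_one hx hx1).sum_le_tsum _ fun k _ ↦ by positivity
    _ = C * (1 - x)⁻¹ := by rw [tsum_geometric_of_lt_one hx hx1]

theorem pow_le_exp_mul_descFactorial {n v : ℕ} (h : v ≤ n) :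
    (n : ℝ) ^ v ≤ Real.exp v * n.descFactorial v := by
  induction v generalizing n with
  | zero => simp
  | succ v ih =>
    obtain ⟨n, rfl⟩ : ∃ n', n = n' + 1 := ⟨n - 1, by omega⟩
    have hvn : v ≤ n := by omega
    have hstep : ((n : ℝ) + 1) ^ v ≤ Real.exp 1 * n ^ v := by
      rcases Nat.eq_zero_or_pos n with rfl | hn
      · obtain rfl : v = 0 := by omega
        simp
      · have hn' : (0 : ℝ) < n := by exact_mod_cast hn
        calc ((n : ℝ) + 1) ^ v = (1 / n + 1) ^ v * n ^ v := by
              rw [← mul_pow]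
              congr 1
              field_simp
              ring
          _ ≤ Real.exp (1 / n) ^ v * n ^ v := by
              gcongr
              exact Real.add_one_le_exp _
          _ ≤ Real.exp 1 * n ^ v := by
              rw [← Real.exp_nat_mul]
              gcongr
              rw [mul_one_div, div_le_one hn']
              exact_mod_cast hvn
    rw [Nat.succ_descFactorial_succ]
    push_cast
    calc ((n : ℝ) + 1) ^ (v + 1) = (n + 1) * (n + 1) ^ v := by ring
      _ ≤ (n + 1) * (Real.exp 1 * (Real.exp v * n.descFactorial v)) := by
          gcongr
          refine hstep.trans ?_
          gcongr
          exact ih hvn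
      _ = _ := by rw [Real.exp_add]; ring

/-! ### Combining the packing bound and the rooted count -/

namespace SimpleGraph

variable {V W : Type*}

theorem Connected.exists_adj [Nontrivial W] {F : SimpleGraph W} (hF : F.Connected) (w : W) :
    ∃ w', F.Adj w w' := by
  obtain ⟨x₀, hx₀⟩ := exists_ne w
  obtain ⟨π, hπ⟩ := hF.exists_parent x₀
  exact ⟨π w, (hπ w hx₀.symm).1.symm⟩

/-- In every finite family of copies there is a disjoint subfamily that meets all its members. -/
theorem exists_maximal_disjoint_copies {H : SimpleGraph V} {F : SimpleGraph W} [Nonempty W]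
    (A : Finset (Copy F H)) :
    ∃ S ⊆ A, (∀ φ ∈ S, ∀ ψ ∈ S, ∀ w w', φ w = ψ w' → φ = ψ) ∧
      ∀ φ ∈ A, ∃ ψ ∈ S, ∃ w w', φ w = ψ w' := by
  classical
  obtain ⟨S, hS, hmax⟩ := Finset.exists_max_image
    (A.powerset.filter fun S ↦ ∀ φ ∈ S, ∀ ψ ∈ S, ∀ w w', φ w = ψ w' → φ = ψ) Finset.card
    ⟨∅, by simp⟩
  rw [Finset.mem_filter, Finset.mem_powerset] at hS
  refine ⟨S, hS.1, hS.2, fun φ hφ ↦ ?_⟩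
  by_contra! hcon
  have hφS : φ ∉ S := fun h ↦ hcon φ h (Classical.arbitrary W) (Classical.arbitrary W) rfl
  have := hmax (insert φ S) (by
    rw [Finset.mem_filter, Finset.mem_powerset]
    refine ⟨Finset.insert_subset hφ hS.1, fun ψ₁ h₁ ψ₂ h₂ w w' h ↦ ?_⟩
    rcases Finset.mem_insert.1 h₁ with rfl | h₁' <;>
      rcases Finset.mem_insert.1 h₂ with rfl | h₂'
    · rfl
    · exact absurd h (hcon ψ₂ h₂' w w')
    · exact absurd h.symm (hcon ψ₁ h₁' w' w)
    · exact hS.2 ψ₁ h₁' ψ₂ h₂' w w' h)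
  rw [Finset.card_insert_of_notMem hφS] at this
  omega

/-- Each copy meets a member of a maximal disjoint subfamily. The factor `(e + 1) ^ 2` chooses which
vertices of the two copies coincide; then the copy is rooted there. -/
theorem _root_.IsSparse.card_copies_le [Fintype V] [Fintype W] [Nontrivial W] {n k : ℕ}
    {q : I} {H : SimpleGraph V} [DecidableRel H.Adj] (hH : IsSparse n q H) {F : SimpleGraph W}
    [DecidableRel F.Adj] (hF : F.Connected) {Δ e : ℕ} (hΔ : ∀ w, F.degree w ≤ Δ)
    (he : F.edgeSet.ncard = e) (hv : Fintype.card W = e + 1) {D : ℝ} (hD : n * (q : ℝ) ≤ D)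
    {t : ℝ} (ht : 0 < t) (A : Finset (Copy F H)) (hA : ∀ φ ∈ A, ∑ w, H.degree (φ w) = k) :
    (A.card : ℝ) ≤ (Real.exp 1 * n * (n * (q : ℝ)) ^ e *
      Real.exp (Real.exp 1 * (e + 1 : ℕ) * D + e - k / 2)) * (e + 1) ^ 2 *
        (t ^ e * Real.exp (Δ * k / t)) := by
  classical
  obtain ⟨S, hSA, hdisj, hmeet⟩ := exists_maximal_disjoint_copies A
  have hm := hH.card_disjoint_copies_le (k := k) hF.exists_adj he hv hD
    (fun i ↦ (S.equivFin.symm i).1) (by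
      rintro ⟨i, w⟩ ⟨j, w'⟩ h
      have hij := hdisj _ (S.equivFin.symm i).2 _ (S.equivFin.symm j).2 w w' h
      have hij' : i = j := S.equivFin.symm.injective (Subtype.ext hij)
      subst hij'
      congr 1
      exact (S.equivFin.symm i).1.injective h)
    (fun i ↦ (hA _ (hSA (S.equivFin.symm i).2)).ge)
  have hsub : A ⊆ (S ×ˢ (Finset.univ : Finset (W × W))).biUnion
      fun x ↦ A.filter fun φ ↦ φ x.2.1 = x.1 x.2.2 := by
    intro φ hφ
    obtain ⟨ψ, hψ, w, w', h⟩ := hmeet φ hφ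
    rw [Finset.mem_biUnion]
    exact ⟨(ψ, w, w'), by simp [hψ], by simp [hφ, h]⟩
  have hone : ∀ x ∈ S ×ˢ (Finset.univ : Finset (W × W)),
      ((A.filter fun φ ↦ φ x.2.1 = x.1 x.2.2).card : ℝ) ≤ t ^ e * Real.exp (Δ * k / t) := by
    intro x _
    refine card_copies_rooted_le hF hΔ hv ht k x.2.1 (x.1 x.2.2) _
      (fun φ hφ ↦ (Finset.mem_filter.1 hφ).2) fun φ hφ ↦ ?_
    exact_mod_cast (hA φ (Finset.mem_filter.1 hφ).1).le
  have hcard : (A.card : ℝ) ≤ ∑ x ∈ S ×ˢ (Finset.univ : Finset (W × W)),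
      ((A.filter fun φ ↦ φ x.2.1 = x.1 x.2.2).card : ℝ) := by
    exact_mod_cast (Finset.card_le_card hsub).trans Finset.card_biUnion_le
  refine hcard.trans ((Finset.sum_le_card_nsmul _ _ _ hone).trans ?_)
  rw [nsmul_eq_mul, Finset.card_product, Finset.card_univ, Fintype.card_prod, hv]
  push_cast at hm ⊢
  rw [← pow_two]
  gcongr

/-- In a sparse graph the number of labelled copies of a tree with `e` edges and bounded degree is
at most `n (C n q) ^ e`. -/
theorem _root_.IsSparse.labelledCopyCount_le [Fintype V] [Fintype W] [Nontrivial W] {n : ℕ}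
    {q : I} {H : SimpleGraph V} (hH : IsSparse n q H) {F : SimpleGraph W}
    [DecidableRel F.Adj] (hF : F.Connected) {Δ e : ℕ} (hΔ : ∀ w, F.degree w ≤ Δ) (hΔ0 : 0 < Δ)
    (he : F.edgeSet.ncard = e) (hv : Fintype.card W = e + 1) (hn : 0 < n * (q : ℝ)) :
    (H.labelledCopyCount F : ℝ) ≤
      28 * (n * (n * (q : ℝ)) ^ e * (32 * Δ * Real.exp 28) ^ e) := by
  classical
  set d : ℝ := n * q with hd
  have he1 : 1 ≤ e := by
    have := Fintype.one_lt_card (α := W)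
    omega
  have hΔ' : (0 : ℝ) < Δ := by exact_mod_cast hΔ0
  have hexp1 : Real.exp 1 ≤ 3 := Real.exp_one_lt_three.le
  have he1' : (1 : ℝ) ≤ e := by exact_mod_cast he1
  let M : Copy F H → ℕ := fun φ ↦ ∑ w, H.degree (φ w)
  set D : ℝ := max d 1 with hD
  have hD1 : 1 ≤ D := le_max_right _ _
  have hsq : ((e : ℝ) + 1) ^ 2 ≤ 4 ^ e := by
    have h1 : ((e : ℝ) + 1) ≤ 2 ^ e := by exact_mod_cast Nat.lt_two_pow_self (n := e)
    calc ((e : ℝ) + 1) ^ 2 ≤ (2 ^ e) ^ 2 := by gcongr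
      _ = 4 ^ e := by rw [← pow_mul, mul_comm, pow_mul]; norm_num
  -- For `d < 1` every copy is treated here, because the packing bound supplies the factor `d ^ e`
  -- even then.
  have hbad : ∀ k : ℕ, ∀ A : Finset (Copy F H), (∀ φ ∈ A, M φ = k) →
      (d < 1 ∨ 28 * e * D ≤ k) → (A.card : ℝ) ≤
        3 * (n * d ^ e * (32 * Δ * Real.exp 28) ^ e) * Real.exp (-(1 / 8)) ^ k := by
    intro k A hA hk
    have hmain := hH.card_copies_le hF hΔ he hv (le_max_left d 1) (t := 8 * Δ) (by positivity) A hA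
    have hk0 : (0 : ℝ) ≤ k := Nat.cast_nonneg k
    -- Of `-k/2 + k/8`, the part `-k/8` is kept for the geometric series. The remaining `-k/4`
    -- absorbs the terms of size at most `7eD` once `k ≥ 28eD`; if `d < 1` they are at most `7e`
    -- anyway.
    have hexpo : Real.exp 1 * (e + 1 : ℕ) * D + e - k / 2 + Δ * k / (8 * Δ) ≤
        e * 28 + k * (-(1 / 8)) := by
      have h1 : (Δ : ℝ) * k / (8 * Δ) = k / 8 := by field_simp
      have h2 : Real.exp 1 * (e + 1 : ℕ) * D ≤ 6 * e * D := by
        push_cast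
        have : Real.exp 1 * (e + 1) ≤ 6 * e := by nlinarith
        gcongr
      have h3 : (e : ℝ) ≤ e * D := le_mul_of_one_le_right (by positivity) hD1
      rw [h1]
      rcases hk with hk | hk
      · have hD' : D = 1 := max_eq_right hk.le
        rw [hD'] at h2 h3 ⊢
        linarith
      · linarith
    calc (A.card : ℝ) ≤ _ := hmain
      _ = Real.exp 1 * (n * d ^ e * ((e + 1) ^ 2 * (8 * Δ) ^ e) *
          Real.exp (Real.exp 1 * (e + 1 : ℕ) * D + e - k / 2 + Δ * k / (8 * Δ))) := by
          rw [Real.exp_add (Real.exp 1 * (e + 1 : ℕ) * D + e - k / 2)]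
          ring
      _ ≤ 3 * (n * d ^ e * (4 ^ e * (8 * Δ) ^ e) * Real.exp (e * 28 + k * (-(1 / 8)))) := by
          gcongr
      _ = _ := by
          rw [Real.exp_add, Real.exp_nat_mul, Real.exp_nat_mul, ← mul_pow]
          ring
  have hexp_le : Real.exp (-(1 / 8)) ≤ 8 / 9 := by
    rw [Real.exp_neg, inv_le_comm₀ (Real.exp_pos _) (by norm_num)]
    have := Real.add_one_le_exp (1 / 8 : ℝ)
    norm_num at this ⊢
    linarith
  have hexp_lt : Real.exp (-(1 / 8)) < 1 := hexp_le.trans_lt (by norm_num)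
  have hgeom : (1 - Real.exp (-(1 / 8)))⁻¹ ≤ 9 := by
    rw [inv_le_comm₀ (by linarith) (by norm_num)]
    linarith
  have hlab : H.labelledCopyCount F = (Finset.univ : Finset (Copy F H)).card := by
    rw [labelledCopyCount_eq_natCard, Nat.card_eq_fintype_card, Finset.card_univ]
  have hsplit := Finset.card_filter_add_card_filter_not (s := (Finset.univ : Finset (Copy F H)))
    (fun φ ↦ d < 1 ∨ 28 * e * D ≤ (M φ : ℝ))
  have hX : (0 : ℝ) ≤ n * d ^ e * (32 * Δ * Real.exp 28) ^ e := by positivity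
  have hB : ((Finset.univ.filter fun φ : Copy F H ↦ d < 1 ∨ 28 * e * D ≤ (M φ : ℝ)).card : ℝ) ≤
      27 * (n * d ^ e * (32 * Δ * Real.exp 28) ^ e) := by
    refine (card_le_of_fiber_le_geometric _ M (by positivity) (Real.exp_pos _).le hexp_lt
      fun k ↦ ?_).trans (b := 3 * (n * d ^ e * (32 * Δ * Real.exp 28) ^ e) *
        (1 - Real.exp (-(1 / 8)))⁻¹) ?_
    · set A := ({a ∈ Finset.univ.filter fun φ : Copy F H ↦ d < 1 ∨ 28 * e * D ≤ (M φ : ℝ) |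
        M a = k} : Finset (Copy F H)) with hA
      rcases A.eq_empty_or_nonempty with h0 | ⟨φ, hφ⟩
      · rw [h0, Finset.card_empty, Nat.cast_zero]
        positivity
      · refine hbad k A (fun ψ hψ ↦ (Finset.mem_filter.1 hψ).2) ?_
        have h1 := Finset.mem_filter.1 hφ
        have h2 := (Finset.mem_filter.1 h1.1).2
        rwa [h1.2] at h2
    · nlinarith
  -- Here `d ≥ 1`, and `t = Δd` makes the exponential exactly `exp(28e)` while `t ^ e` supplies `d ^
  -- e`.
  have hG : ((Finset.univ.filter fun φ : Copy F H ↦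
      ¬ (d < 1 ∨ 28 * e * D ≤ (M φ : ℝ))).card : ℝ) ≤
      n * d ^ e * (32 * Δ * Real.exp 28) ^ e := by
    set A := Finset.univ.filter fun φ : Copy F H ↦ ¬ (d < 1 ∨ 28 * e * D ≤ (M φ : ℝ)) with hA
    rcases A.eq_empty_or_nonempty with h0 | ⟨φ₀, hφ₀⟩
    · rw [h0, Finset.card_empty, Nat.cast_zero]
      exact hX
    have hd1 : 1 ≤ d := by
      have := (Finset.mem_filter.1 hφ₀).2
      push Not at this
      exact this.1
    have hDd : D = d := max_eq_left hd1
    obtain ⟨x₀⟩ : Nonempty W := inferInstance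
    have hroot : ∀ u ∈ (Finset.univ : Finset V), ((A.filter fun φ ↦ φ x₀ = u).card : ℝ) ≤
        (Δ * d) ^ e * Real.exp (Δ * (28 * e * d) / (Δ * d)) := by
      intro u _
      refine card_copies_rooted_le hF hΔ hv (by positivity) (28 * e * d) x₀ u _
        (fun φ hφ ↦ (Finset.mem_filter.1 hφ).2) fun φ hφ ↦ ?_
      have := (Finset.mem_filter.1 (Finset.mem_filter.1 hφ).1).2
      push Not at this
      rw [hDd] at this
      exact_mod_cast this.2.le
    have hcard : (A.card : ℝ) = ∑ u : V, ((A.filter fun φ ↦ φ x₀ = u).card : ℝ) := by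
      exact_mod_cast Finset.card_eq_sum_card_fiberwise (f := fun φ : Copy F H ↦ φ x₀)
        (t := Finset.univ) (by simp)
    rw [hcard]
    refine (Finset.sum_le_card_nsmul _ _ _ hroot).trans ?_
    have hVn : (Fintype.card V : ℝ) ≤ n := by exact_mod_cast hH.card_le
    have h1 : (Δ : ℝ) * (28 * e * d) / (Δ * d) = e * 28 := by
      field_simp
    rw [nsmul_eq_mul, Finset.card_univ, h1, Real.exp_nat_mul]
    calc (Fintype.card V : ℝ) * ((Δ * d) ^ e * Real.exp 28 ^ e)
        ≤ n * ((Δ * d) ^ e * Real.exp 28 ^ e) := by gcongr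
      _ = n * d ^ e * (Δ * Real.exp 28) ^ e := by ring
      _ ≤ _ := by
          gcongr
          linarith
  rw [hlab, ← hsplit]
  push_cast
  linarith

end SimpleGraph

/-! ### Conclusion -/

theorem theorem1p4 (Δ : ℕ) (hΔ : 0 < Δ) :
    ∃ L : ℝ, 0 < L ∧
      ∀ (n : ℕ) (q p : I), 0 < (q : ℝ) → (p : ℝ) = L * (q : ℝ) →
      ∀ (V : Type*) [Fintype V] (H : SimpleGraph V), IsSparse n q H →
      ∀ (W : Type*) [Fintype W] (F : SimpleGraph W) [DecidableRel F.Adj],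
        F.IsTree → F.maxDegree = Δ → Fintype.card W ≤ n →
          (H.copyCount F : ℝ) < expectedCopyCount n p F := by
  classical
  have hΔ' : (0 : ℝ) < Δ := by exact_mod_cast hΔ
  -- `29` exceeds the constant `28`, giving strictness; `exp 2` pays for the falling factorial, as
  -- `e + 1 ≤ 2e`.
  refine ⟨29 * (32 * Δ * Real.exp 28) * Real.exp 2, by positivity, ?_⟩
  intro n q p hq hp V _ H hH W _ F _ hF hmax hWn
  have hdeg : ∀ w, F.degree w ≤ Δ := fun w ↦ hmax ▸ F.degree_le_maxDegree w
  have : Nonempty W := hF.1.nonempty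
  have hnontriv : Nontrivial W := by
    obtain ⟨w, hw⟩ := F.exists_maximal_degree_vertex
    rw [hmax] at hw
    obtain ⟨w', h'⟩ := (F.degree_pos_iff_exists_adj w).1 (hw ▸ hΔ)
    exact ⟨w, w', h'.ne⟩
  obtain ⟨e, hv⟩ : ∃ e, Fintype.card W = e + 1 :=
    ⟨Fintype.card W - 1, by have := Fintype.card_pos (α := W); omega⟩
  have he1 : e ≠ 0 := by
    have := Fintype.one_lt_card (α := W)
    omega
  have he : F.edgeSet.ncard = e := by
    have := hF.card_edgeFinset
    rw [← F.coe_edgeFinset, Set.ncard_coe_finset]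
    omega
  have hn : (0 : ℝ) < n := by
    have : 0 < n := by omega
    exact_mod_cast this
  have hn' : 0 < n * (q : ℝ) := by positivity
  have hub := hH.labelledCopyCount_le hF.1 hdeg hΔ he hv hn'
  have hlow := pow_le_exp_mul_descFactorial hWn
  rw [expectedCopyCount_eq, he]
  have hA : (0 : ℝ) < Nat.card (F ≃g F) := by
    have : Nonempty (F ≃g F) := ⟨SimpleGraph.Iso.refl⟩
    have : Finite (F ≃g F) := Finite.of_injective _ DFunLike.coe_injective
    exact_mod_cast Nat.card_pos
  refine lt_of_mul_lt_mul_left ?_ hA.le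
  rw [mul_left_comm]
  have h1 := SimpleGraph.card_aut_mul_copyCount H F
  have h2 := SimpleGraph.card_aut_mul_copyCount (⊤ : SimpleGraph (Fin n)) F
  rw [SimpleGraph.labelledCopyCount_top, Fintype.card_fin] at h2
  have h1' : (Nat.card (F ≃g F) : ℝ) * H.copyCount F = H.labelledCopyCount F := by
    exact_mod_cast h1
  have h2' : (Nat.card (F ≃g F) : ℝ) * (⊤ : SimpleGraph (Fin n)).copyCount F =
      n.descFactorial (Fintype.card W) := by exact_mod_cast h2
  rw [h1', h2', hp]
  set K : ℝ := 32 * Δ * Real.exp 28 with hK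
  have hK0 : 0 < K := by positivity
  clear_value K
  have hexp : Real.exp (Fintype.card W) ≤ Real.exp 2 ^ e := by
    rw [← Real.exp_nat_mul, hv]
    gcongr
    push_cast
    have : (1 : ℝ) ≤ e := by exact_mod_cast Nat.one_le_iff_ne_zero.2 he1
    linarith
  calc (H.labelledCopyCount F : ℝ) ≤ 28 * (n * (n * (q : ℝ)) ^ e * K ^ e) := hub
    _ < 29 * (n * (n * (q : ℝ)) ^ e * K ^ e) := by
        have : 0 < n * (n * (q : ℝ)) ^ e * K ^ e := by positivity
        linarith
    _ ≤ 29 ^ e * (n * (n * (q : ℝ)) ^ e * K ^ e) := by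
        gcongr
        exact le_self_pow₀ (by norm_num) he1
    _ = (29 * K * q) ^ e * (n : ℝ) ^ Fintype.card W := by
        rw [hv]
        ring
    _ ≤ (29 * K * q) ^ e * (Real.exp 2 ^ e * n.descFactorial (Fintype.card W)) := by
        gcongr
        refine hlow.trans ?_
        gcongr
    _ = _ := by ring
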